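/- Let $k$ be an algebraically closed field of characteristic zero, $G$ an almost simple, simply connected affine algebraic group over $k$, $T\subset G$ a maximal torus, and $\mathfrak t=\operatorname{Lie}T\subset\mathfrak g=\operatorname{Lie}G$ (these pairs $(\mathfrak g,\mathfrak t)$ are exactly the finite-dimensional simple Lie algebras over $k$ with a Cartan subalgebra). Let $\mathfrak g=\mathfrak t\oplus\bigoplus_{r\in\Phi}\mathfrak g_r$ be the root decomposition, $Q=\mathbb Z\Phi$ the root lattice, $T_{ad}$ the torus with character lattice $Q$, acting on $\mathfrak g$ by $\mathrm{Ad}$ (trivially on $\mathfrak t$, through $r$ on $\mathfrak g_r$), and $Y(T)$ the cocharacter lattice of $T$, i.e. the coroot lattice. Let $n\ge 0$ and let $\boldsymbol\Theta=(\theta_1,\dots,\theta_n)$ be an $n$-tuple of rational points of the apartment of $T$, i.e. $\theta_i\in Y(T)\otimes\mathbb Q$. There is an integer $d\ge 1$ with $d\,r(\theta_i)\in\mathbb Z$ for all $i$ and all $r\in\Phi$; for such a $d$, each $d\theta_i$ is a cocharacter of $T_{ad}$. Let $B_0^+=k[x_1,\dots,x_n]$, $B_0=k[x_1^{\pm1},\dots,x_n^{\pm1}]$,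 $\mathbf A=\operatorname{Spec}B_0^+=\mathbb A^n_k$, and let $\mathbf A_0=\operatorname{Spec}B_0\subset\mathbf A$ be the complement of the coordinate hyperplanes. For $d$ as above let $B^+=k[y_1,\dots,y_n]$, $B=k[y_1^{\pm1},\dots,y_n^{\pm1}]$, and let $$j:\ \mathfrak g(B_0)\longrightarrow\mathfrak g(B)$$ be the map given by $x_i\mapsto y_i^d$ followed by $\mathrm{Ad}\big(\prod_i (d\theta_i)(y_i)\big)$, where $\mathfrak g(A)=A\otimes_k\mathfrak g$. For a $k$-algebra $R$ put $R(\!(z_1,\dots,z_n)\!)=R[\![z_1,\dots,z_n]\!][z_1^{-1},\dots,z_n^{-1}]$ and $L_n\mathfrak g(R)=\mathfrak g\big(R(\!(z_1,\dots,z_n)\!)\big)$. The $n$-parahoric Lie algebra $\mathfrak P_{\boldsymbol\Theta}(R)$ is the set of all $h(z_1,\dots,z_n)\in L_n\mathfrak g(R)$ for which $$\lim_{s_i\to0}\ \mathrm{Ad}\Big(\prod_i\theta_i(s_i)\Big)\,h(s_1z_1,\dots,s_nz_n)$$ exists, i.e. for which there is a $d\ge1$ as above such that for $s_i=w_i^d$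 this element of $L_n\mathfrak g\big(R(\!(w_1,\dots,w_n)\!)\big)$ lies in $L_n\mathfrak g\big(R[\![w_1,\dots,w_n]\!]\big)$. **Theorem.** There is a $B_0^+$-Lie subalgebra $\mathcal R\subset\mathfrak g(B_0)$ such that $$\mathcal R=j^{-1}\big(j(\mathfrak g(B_0))\cap\mathfrak g(B^+)\big)$$ for every $d$ as above (so $\mathcal R$ is canonical and independent of $d$), and 1. $\mathcal R$ is a Lie algebra bundle on $\mathbf A$, i.e. a finitely generated projective $B_0^+$-module with a $B_0^+$-bilinear Lie bracket; 2. $\mathcal R$ extends the trivial bundle with fibre $\mathfrak g$ on $\mathbf A_0$: the map $b\otimes m\mapsto b\,m$ is an isomorphism $B_0\otimes_{B_0^+}\mathcal R\to\mathfrak g(B_0)$ of Lie algebras over $B_0$; 3. on the formal neighbourhood $V=\operatorname{Spec}\mathcal O_n$, $\mathcal O_n=k[\![z_1,\dots,z_n]\!]$, $x_i\mapsto z_i$, of the origin there is an identification $$L_n^+(\mathcal R|_V)=L_n^+(\mathfrak P_{\boldsymbol\Theta})$$ of functors from $k$-algebras to $k$-Lie algebras, where $\mathcal R|_V=\mathcal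 O_n\otimes_{B_0^+}\mathcal R$, $L_n^+(\mathcal R|_V)(R)=R[\![z_1,\dots,z_n]\!]\otimes_{\mathcal O_n}\mathcal R|_V$ and $L_n^+(\mathfrak P_{\boldsymbol\Theta})(R)=\mathfrak P_{\boldsymbol\Theta}(R)$: for every $k$-algebra $R$ the canonical map of $R[\![z_1,\dots,z_n]\!]$-Lie algebras $L_n^+(\mathcal R|_V)(R)\to L_n\mathfrak g(R)$ is injective with image exactly $\mathfrak P_{\boldsymbol\Theta}(R)$, and these maps are compatible with all homomorphisms $R\to R'$ of $k$-algebras. -/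

import Mathlib

universe u v w

open scoped TensorProduct

noncomputable section

namespace ParahoricLie

/-! ### Laurent polynomials and Laurent series in several variables -/

section Laurent

/-- `k[x₁^{±1}, …, xₙ^{±1}]`, the coordinate ring of the complement of the coordinate hyperplanes
in affine `n`-space `Spec k[x₁, …, xₙ]`. -/
abbrev MvLaurentPoly (n : ℕ) (k : Type*) [CommRing k] : Type _ :=
  Localization.Away (∏ i : Fin n, (MvPolynomial.X i : MvPolynomial (Fin n) k))

/-- `R((z₁, …, zₙ)) = R⟦z₁, …, zₙ⟧[z₁⁻¹, …, zₙ⁻¹]`. -/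
abbrev MvLaurentSeries (n : ℕ) (R : Type*) [CommRing R] : Type _ :=
  Localization.Away (∏ i : Fin n, (MvPowerSeries.X i : MvPowerSeries (Fin n) R))

/-- A `k`-algebra map that inverts `∏ xᵢ` extends to the localization away from `∏ xᵢ`. -/
def awayLift {k P A : Type*} [CommRing k] [CommRing P] [Algebra k P] [CommRing A] [Algebra k A]
    {n : ℕ} (x : Fin n → P) (f : P →ₐ[k] A) (h : ∀ i, IsUnit (f (x i))) :
    Localization.Away (∏ i, x i) →ₐ[k] A :=
  IsLocalization.Away.liftAlgHom (∏ i, x i) (f := f) (by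
    rw [map_prod, IsUnit.prod_univ_iff]; exact h)

theorem awayLift_algebraMap {k P A : Type*} [CommRing k] [CommRing P] [Algebra k P] [CommRing A]
    [Algebra k A] {n : ℕ} (x : Fin n → P) (f : P →ₐ[k] A) (h : ∀ i, IsUnit (f (x i))) (p : P) :
    awayLift x f h (algebraMap P _ p) = f p := by
  rw [awayLift, IsLocalization.Away.liftAlgHom_apply, IsLocalization.Away.lift_eq]
  rfl

theorem isUnit_away {P : Type*} [CommRing P] {n : ℕ} (x : Fin n → P) (i : Fin n) :
    IsUnit (algebraMap P (Localization.Away (∏ i, x i)) (x i)) :=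
  IsLocalization.Away.isUnit_of_dvd (∏ i, x i) (Finset.dvd_prod_of_mem x (Finset.mem_univ i))

/-- The variable `xᵢ` as a unit of the localization away from `∏ xᵢ`. -/
def varUnit {P : Type*} [CommRing P] {n : ℕ} (x : Fin n → P) (i : Fin n) :
    (Localization.Away (∏ i, x i))ˣ :=
  (isUnit_away x i).unit

/-- The inclusion `k[x₁^{±1}, …, xₙ^{±1}] → k[y₁^{±1}, …, yₙ^{±1}]`, `xᵢ ↦ yᵢ ^ d`. -/
def rootCover (n : ℕ) (k : Type*) [CommRing k] (d : ℕ) :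
    MvLaurentPoly n k →ₐ[k] MvLaurentPoly n k :=
  awayLift MvPolynomial.X
    (MvPolynomial.aeval fun i => algebraMap (MvPolynomial (Fin n) k) (MvLaurentPoly n k)
      (MvPolynomial.X i) ^ d)
    (fun i => by
      rw [MvPolynomial.aeval_X]
      exact (isUnit_away (MvPolynomial.X : Fin n → MvPolynomial (Fin n) k) i).pow d)

section

variable {k : Type*} [CommRing k] {n : ℕ}

/-- The map `R((z₁, …, zₙ)) → R'((z₁, …, zₙ))` applying `φ : R → R'` to the coefficients. -/
def seriesMap {R R' : Type*} [CommRing R] [Algebra k R] [CommRing R'] [Algebra k R']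
    (φ : R →ₐ[k] R') : MvLaurentSeries n R →ₐ[k] MvLaurentSeries n R' :=
  awayLift MvPowerSeries.X
    ((IsScalarTower.toAlgHom k (MvPowerSeries (Fin n) R') (MvLaurentSeries n R')).comp
      (MvPowerSeries.mapAlgHom φ))
    (fun i => by
      simpa [MvPowerSeries.mapAlgHom_apply] using
        isUnit_away (MvPowerSeries.X : Fin n → MvPowerSeries (Fin n) R') i)

/-- The expansion `k[x₁^{±1}, …, xₙ^{±1}] → R((z₁, …, zₙ))`, `xᵢ ↦ zᵢ`, at the origin. -/
def expansion (n : ℕ) (k : Type*) [CommRing k] (R : Type*) [CommRing R] [Algebra k R] :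
    MvLaurentPoly n k →ₐ[k] MvLaurentSeries n R :=
  awayLift MvPolynomial.X
    (MvPolynomial.aeval fun i => algebraMap (MvPowerSeries (Fin n) R) (MvLaurentSeries n R)
      (MvPowerSeries.X i))
    (fun i => by
      rw [MvPolynomial.aeval_X]
      exact isUnit_away (MvPowerSeries.X : Fin n → MvPowerSeries (Fin n) R) i)

theorem rescale_X {R : Type*} [CommRing R] (u : Fin n → R) (i : Fin n) :
    MvPowerSeries.rescale u (MvPowerSeries.X i : MvPowerSeries (Fin n) R) =
      MvPowerSeries.C (u i) * MvPowerSeries.X i := by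
  classical
  ext m
  rw [MvPowerSeries.coeff_rescale, MvPowerSeries.coeff_C_mul, MvPowerSeries.coeff_X]
  split_ifs with h
  · subst h; simp
  · simp

/-- Loop rotation by `u ∈ 𝔾ₘⁿ(R)`: the automorphism `f(z₁, …, zₙ) ↦ f(u₁ z₁, …, uₙ zₙ)` of
`R((z₁, …, zₙ))`. -/
def loopRotation {R : Type*} [CommRing R] [Algebra k R] (u : Fin n → Rˣ) :
    MvLaurentSeries n R →ₐ[k] MvLaurentSeries n R :=
  awayLift MvPowerSeries.X
    (((IsScalarTower.toAlgHom R (MvPowerSeries (Fin n) R) (MvLaurentSeries n R)).comp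
      (MvPowerSeries.rescaleAlgHom fun i => (u i : R))).restrictScalars k)
    (fun i => by
      have h := isUnit_away (MvPowerSeries.X : Fin n → MvPowerSeries (Fin n) R) i
      have h' : IsUnit (MvPowerSeries.C (σ := Fin n) (u i : R)) := (u i).isUnit.map _
      simpa [MvPowerSeries.rescaleAlgHom_apply, rescale_X] using
        (h'.map (algebraMap (MvPowerSeries (Fin n) R) (MvLaurentSeries n R))).mul h)

end

end Laurent

/-! ### Semisimple Lie algebras: weights, adjoint torus, apartment -/

section Lie

variable {k 𝔤 : Type*} [Field k] [IsAlgClosed k] [LieRing 𝔤] [LieAlgebra k 𝔤]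
  [FiniteDimensional k 𝔤]

/-- `𝔤(A) = A ⊗ 𝔤 → 𝔤(B) = B ⊗ 𝔤` for a homomorphism `A → B` of `k`-algebras. -/
def extMap (𝔤 : Type*) [LieRing 𝔤] [LieAlgebra k 𝔤] {A B : Type*} [CommRing A] [Algebra k A]
    [CommRing B] [Algebra k B] (f : A →ₐ[k] B) : (A ⊗[k] 𝔤) →ₗ⁅k⁆ (B ⊗[k] 𝔤) :=
  LieAlgebra.ExtendScalars.map f LieHom.id

/-- If `A` is a localization of `P`, then the Lie algebra `𝔤(A)` is a Lie algebra over `P`. -/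
instance instLieAlgebraAway {P : Type*} [CommRing P] [Algebra k P] (x : P) :
    LieAlgebra P (Localization.Away x ⊗[k] 𝔤) where
  lie_smul p a b := by
    have h := LieAlgebra.lie_smul (algebraMap P (Localization.Away x) p) a b
    rwa [algebraMap_smul, algebraMap_smul] at h

variable (H : LieSubalgebra k 𝔤) [H.IsCartanSubalgebra]

open LieModule

/-- The weight space of `χ` for the action of the Cartan subalgebra `H` on `𝔤`: it is `H` itself for
`χ = 0` and the root space `𝔤_χ` if `χ` is a root. -/
def weightSpaceOf (χ : Weight k H 𝔤) : Submodule k 𝔤 :=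
  (LieAlgebra.rootSpace H χ).toSubmodule

open scoped Classical in
theorem isInternal_weightSpaceOf :
    Function.Bijective (DirectSum.coeLinearMap (weightSpaceOf H)) :=
  DirectSum.isInternal_submodule_of_iSupIndep_of_iSup_eq_top
    (LieSubmodule.iSupIndep_toSubmodule.mpr <| iSupIndep_genWeightSpace' k H 𝔤)
    (LieSubmodule.iSup_toSubmodule_eq_top.mpr <| iSup_genWeightSpace_eq_top' k H 𝔤)

open scoped Classical in
/-- The projection of `𝔤` onto the `χ`-component of `𝔤 = H ⊕ ⨁ 𝔤_α`. -/
def weightProj (χ : Weight k H 𝔤) : 𝔤 →ₗ[k] 𝔤 :=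
  (weightSpaceOf H χ).subtype ∘ₗ DirectSum.component k _ _ χ ∘ₗ
    (LinearEquiv.ofBijective (DirectSum.coeLinearMap (weightSpaceOf H))
      (isInternal_weightSpaceOf H)).symm.toLinearMap

open scoped Classical in
theorem weightProj_apply (χ ψ : Weight k H 𝔤) {v : 𝔤} (hv : v ∈ weightSpaceOf H ψ) :
    weightProj H χ v = if χ = ψ then v else 0 := by
  have h : (LinearEquiv.ofBijective (DirectSum.coeLinearMap (weightSpaceOf H))
      (isInternal_weightSpaceOf H)).symm v = DirectSum.lof k _ _ ψ ⟨v, hv⟩ := by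
    rw [LinearEquiv.symm_apply_eq]
    simp [DirectSum.coeLinearMap_lof]
  simp only [weightProj, LinearMap.comp_apply, LinearEquiv.coe_coe, h]
  split_ifs with e
  · subst e; simp [DirectSum.component.lof_self]
  · simp [DirectSum.component.of, Ne.symm e]

variable [CharZero k]

/-- The root lattice (it is the character lattice of the adjoint torus `T_ad`). -/
def rootLattice : AddSubgroup (Module.Dual k H) :=
  AddSubgroup.closure (Set.range fun χ : Weight k H 𝔤 => χ.toLinear)

/-- A weight of `H` on `𝔤` as an element of the root lattice. -/
def weightChar (χ : Weight k H 𝔤) : rootLattice H :=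
  ⟨χ.toLinear, AddSubgroup.subset_closure ⟨χ, rfl⟩⟩

/-- The points of the adjoint torus `T_ad = Spec k[root lattice]` with values in `A`. -/
abbrev AdjointTorus (A : Type*) [CommRing A] : Type _ :=
  Multiplicative (rootLattice H) →* Aˣ

/-- The lattice of cocharacters of the adjoint torus `T_ad`. -/
abbrev AdjointCochar : Type _ :=
  rootLattice H →+ ℤ

/-- The adjoint action of `t ∈ T_ad(A)` on `𝔤(A)`: it multiplies the `χ`-component by `χ(t)`. -/
def Ad {A : Type*} [CommRing A] [Algebra k A] (t : AdjointTorus H A) :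
    (A ⊗[k] 𝔤) →ₗ[A] (A ⊗[k] 𝔤) :=
  ∑ χ : Weight k H 𝔤,
    (t (Multiplicative.ofAdd (weightChar H χ)) : A) • (weightProj H χ).baseChange A

theorem Ad_tmul {A : Type*} [CommRing A] [Algebra k A] (t : AdjointTorus H A)
    (χ : Weight k H 𝔤) {v : 𝔤} (hv : v ∈ weightSpaceOf H χ) (a : A) :
    Ad H t (a ⊗ₜ v) = ((t (Multiplicative.ofAdd (weightChar H χ)) : A) * a) ⊗ₜ v := by
  classical
  simp only [Ad, LinearMap.sum_apply, LinearMap.smul_apply, LinearMap.baseChange_tmul]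
  rw [Finset.sum_eq_single χ]
  · simp [weightProj_apply H χ χ hv, TensorProduct.smul_tmul']
  · intro ψ _ hψ
    simp [weightProj_apply H ψ χ hv, hψ]
  · simp

variable {H} in
/-- The point `∏ᵢ μᵢ(uᵢ) ∈ T_ad(A)`, for cocharacters `μ₁, …, μₙ` of `T_ad` and `u ∈ 𝔾ₘⁿ(A)`. -/
def cocharPoint {n : ℕ} {A : Type*} [CommRing A] (μ : Fin n → AdjointCochar H)
    (u : Fin n → Aˣ) : AdjointTorus H A where
  toFun r := ∏ i, u i ^ μ i r.toAdd
  map_one' := by simp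
  map_mul' r s := by simp [zpow_add, Finset.prod_mul_distrib]

variable [LieAlgebra.IsKilling k 𝔤]

/-- The lattice `Y(T)` of one-parameter subgroups of the maximal torus `T` with Lie algebra `H` of
the simply connected group with Lie algebra `𝔤`. It is the coroot lattice, embedded in `H` by
`λ ↦ dλ(1)`. -/
def cocharLattice : AddSubgroup H :=
  AddSubgroup.closure (Set.range fun α : Weight k H 𝔤 => LieAlgebra.IsKilling.coroot α)

/-- The rational points `Y(T) ⊗ ℚ` of the apartment of `T`, i.e. the rational one-parameter subgroups
of `T`, seen in `H = Y(T) ⊗ k`. -/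
def apartment : Set H :=
  {θ | ∃ N : ℕ, 0 < N ∧ N • θ ∈ cocharLattice H}

variable {H}

/-- The cocharacters `μ₁, …, μₙ` of `T_ad` are the multiples `d θ₁, …, d θₙ` of points of the
apartment: `⟨r, μᵢ⟩ = d r(θᵢ)` for all `r` in the root lattice. -/
def IsMultiple {n : ℕ} (d : ℕ) (θ : Fin n → apartment H) (μ : Fin n → AdjointCochar H) : Prop :=
  ∀ i (r : rootLattice H), ((μ i r : ℤ) : k) = d * (r : Module.Dual k H) (θ i : H)

/-- The map `j : 𝔤(k[x^{±1}]) → 𝔤(k[y^{±1}])`, which is `xᵢ ↦ yᵢ ^ d` followed by the adjoint action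
of the point `∏ᵢ μᵢ(yᵢ)` of `T_ad`. -/
def twist {n : ℕ} (d : ℕ) (μ : Fin n → AdjointCochar H) :
    (MvLaurentPoly n k ⊗[k] 𝔤) →ₗ[k] (MvLaurentPoly n k ⊗[k] 𝔤) :=
  (Ad H (cocharPoint μ (varUnit MvPolynomial.X))).restrictScalars k ∘ₗ
    (extMap 𝔤 (rootCover n k d)).toLinearMap

/-- `𝔤(k[y₁, …, yₙ])`, as a subset of `𝔤(k[y₁^{±1}, …, yₙ^{±1}])`. -/
def regularPart (k 𝔤 : Type*) [Field k] [LieRing 𝔤] [LieAlgebra k 𝔤] (n : ℕ) :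
    Set (MvLaurentPoly n k ⊗[k] 𝔤) :=
  Set.range (extMap 𝔤 (IsScalarTower.toAlgHom k (MvPolynomial (Fin n) k) (MvLaurentPoly n k)))

/-- `Ad (∏ᵢ ηᵢ(sᵢ)) (h)` for `h ∈ Lₙ𝔤(R) = 𝔤(R((z₁, …, zₙ)))`, `ηᵢ = (eᵢ, θᵢ)` and
`sᵢ = wᵢ ^ d`, where `μᵢ = d θᵢ`, as an element of `Lₙ𝔤(R((w₁, …, wₙ)))`: the factors `eᵢ` rotate the
loop by `zᵢ ↦ sᵢ zᵢ`, and the factors `θᵢ` act by the adjoint action of `∏ᵢ θᵢ(sᵢ) = ∏ᵢ μᵢ(wᵢ)`. -/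
def etaConj {n : ℕ} (d : ℕ) (μ : Fin n → AdjointCochar H) {R : Type*} [CommRing R] [Algebra k R]
    (h : MvLaurentSeries n R ⊗[k] 𝔤) : MvLaurentSeries n (MvLaurentSeries n R) ⊗[k] 𝔤 :=
  let w : Fin n → (MvLaurentSeries n R)ˣ := varUnit MvPowerSeries.X
  Ad H (cocharPoint μ fun i => Units.map
      (algebraMap (MvLaurentSeries n R) (MvLaurentSeries n (MvLaurentSeries n R))).toMonoidHom (w i))
    (extMap 𝔤 (loopRotation (k := k) fun i => w i ^ d)
      (extMap 𝔤 (seriesMap (IsScalarTower.toAlgHom k R (MvLaurentSeries n R))) h))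

/-- The `n`-parahoric Lie algebra `𝔓_Θ(R) ⊆ Lₙ𝔤(R)`: all `h` for which
`lim_{sᵢ → 0} Ad (∏ᵢ ηᵢ(sᵢ)) (h)` exists, that is, for which there is a `d ≥ 1` with `d Θ` integral such
that for `wᵢ ^ d = sᵢ` this element belongs to `Lₙ𝔤(R⟦w₁, …, wₙ⟧)`. -/
def nParahoric {n : ℕ} (θ : Fin n → apartment H) (R : Type*) [CommRing R] [Algebra k R] :
    Set (MvLaurentSeries n R ⊗[k] 𝔤) :=
  {h | ∃ d : ℕ, 0 < d ∧ ∃ μ : Fin n → AdjointCochar H, IsMultiple d θ μ ∧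
    etaConj d μ h ∈ Set.range (extMap 𝔤 (seriesMap (n := n)
      (IsScalarTower.toAlgHom k (MvPowerSeries (Fin n) R) (MvLaurentSeries n R))))}

/-- The restriction `M|_V = 𝒪ₙ ⊗ M` of (the module of sections of) a bundle `M` on affine `n`-space to
`V = Spec 𝒪ₙ`, `𝒪ₙ = k⟦z₁, …, zₙ⟧`, the formal neighbourhood of the origin. -/
abbrev FormalNhd (n : ℕ) (k : Type*) [CommRing k] (M : Type*) [AddCommGroup M]
    [Module (MvPolynomial (Fin n) k) M] : Type _ :=
  MvPowerSeries (Fin n) k ⊗[MvPolynomial (Fin n) k] M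

/-- The positive-loop functor `Lₙ⁺(N) : R ↦ N(R⟦z₁, …, zₙ⟧)` of a bundle `N` on `Spec 𝒪ₙ`. -/
abbrev PosLoop (n : ℕ) (k : Type*) [CommRing k] (N : Type*) [AddCommGroup N]
    [Module (MvPowerSeries (Fin n) k) N] (R : Type*) [CommRing R] [Algebra k R] : Type _ :=
  MvPowerSeries (Fin n) R ⊗[MvPowerSeries (Fin n) k] N

end Lie

end ParahoricLie

end

/-! Everything is diagonal in a basis `b i` of `𝔤` made of weight vectors. If `b i` has weight `r`
and `m j = d r(θ j)`, then `j` sends the coordinate `q(x)` of an element along `b i` to `y^m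
q(y^d)`. Write `m = d⌊m/d⌋ + e` with `0 ≤ e < d`. Since a remainder below `d` cannot compensate for
a missing multiple of `d`, `y^m q(y^d)` is a polynomial exactly when `x^⌊m/d⌋ q` is one. Hence `ℛ`
is free over `k[x]` on the vectors `x^a ⊗ b i` with `a j = -⌊m j/d⌋ = ⌈-r(θ j)⌉`, numbers that do
not involve `d`.

The limit condition is diagonal too: along `b i` it asks that `w^m q(w^d z)` have all its
`z`-coefficients in `R⟦w⟧`, and the same division argument gives `z^⌊m/d⌋ q ∈ R⟦z⟧`. So `𝔓_Θ(R)` is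
free over `R⟦z⟧` on the vectors `z^a ⊗ b i` with the same exponents, and base change matches the two
bases. The two criteria are `varMonomial_mul_rootCover_mem_range_iff` and
`varMonomial_mul_loopPullback_mem_range_iff`; `IsMultiple.ediv_eq` gives independence of `d`.
Closure under the bracket is free of computation: `j` preserves brackets, by `Ad_lie`. -/

noncomputable section

namespace ParahoricLie

/-! ### Lattices spanned by a basis over a subring. -/

section LinearAlgebra

variable {S T M ι : Type*} [CommRing S] [CommRing T] [Algebra S T] [AddCommGroup M]
  [Module T M] [Module S M] [IsScalarTower S T M]

theorem linearIndependent_restrictScalars (hST : Function.Injective (algebraMap S T))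
    (c : Module.Basis ι T M) : LinearIndependent S c :=
  c.linearIndependent.restrict_scalars (by simpa [Algebra.smul_def] using hST)

theorem mem_span_basis_iff [Finite ι] (c : Module.Basis ι T M) (m : M) :
    m ∈ Submodule.span S (Set.range c) ↔ ∀ i, c.repr m i ∈ Set.range (algebraMap S T) := by
  classical
  cases nonempty_fintype ι
  constructor
  · intro hm
    induction hm using Submodule.span_induction with
    | mem x hx =>
      obtain ⟨j, rfl⟩ := hx
      intro i
      rw [c.repr_self, Finsupp.single_apply]
      split_ifs
      exacts [⟨1, map_one _⟩, ⟨0, map_zero _⟩]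
    | zero => exact fun i => ⟨0, by simp⟩
    | add x y _ _ hx hy =>
      intro i
      obtain ⟨a, ha⟩ := hx i
      obtain ⟨b, hb⟩ := hy i
      exact ⟨a + b, by simp [ha, hb]⟩
    | smul s x _ hx =>
      intro i
      obtain ⟨a, ha⟩ := hx i
      refine ⟨s * a, ?_⟩
      rw [← algebraMap_smul T s x, map_smul, Finsupp.smul_apply, smul_eq_mul, map_mul, ha]
  · intro h
    choose a ha using h
    rw [← c.sum_repr m]
    refine Submodule.sum_mem _ fun i _ => ?_
    rw [← ha i, algebraMap_smul]
    exact Submodule.smul_mem _ _ (Submodule.subset_span ⟨i, rfl⟩)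

theorem eq_linearCombination_comp_repr {N : Type*} [AddCommGroup N] [Module S N]
    (b : Module.Basis ι S N) (f : N →ₗ[S] M) :
    f = Finsupp.linearCombination S (f ∘ b) ∘ₗ b.repr.toLinearMap :=
  b.ext fun i => by simp

/-- Together with `range_eq_span_comp`, this reduces the bijectivity, injectivity and image claims
of the theorem to knowing where a basis goes. -/
theorem injective_of_linearIndependent_comp {N : Type*} [AddCommGroup N] [Module S N]
    (b : Module.Basis ι S N) (f : N →ₗ[S] M) (h : LinearIndependent S (f ∘ b)) :
    Function.Injective f := by
  rw [eq_linearCombination_comp_repr b f]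
  exact (Function.Injective.comp (g := Finsupp.linearCombination S (f ∘ b)) h b.repr.injective :)

theorem range_eq_span_comp {N : Type*} [AddCommGroup N] [Module S N]
    (b : Module.Basis ι S N) (f : N →ₗ[S] M) :
    LinearMap.range f = Submodule.span S (Set.range (f ∘ b)) := by
  rw [Set.range_comp, Submodule.span_image, b.span_eq, Submodule.map_top]

end LinearAlgebra

/-! ### Extension of scalars in coordinates. -/

section ExtMap

variable {k 𝔤 : Type*} [Field k] [LieRing 𝔤] [LieAlgebra k 𝔤]
  {A B C : Type*} [CommRing A] [Algebra k A] [CommRing B] [Algebra k B] [CommRing C] [Algebra k C]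

@[simp]
theorem extMap_tmul (f : A →ₐ[k] B) (a : A) (v : 𝔤) : extMap 𝔤 f (a ⊗ₜ v) = f a ⊗ₜ v := rfl

theorem extMap_smul (f : A →ₐ[k] B) (a : A) (h : A ⊗[k] 𝔤) :
    extMap 𝔤 f (a • h) = f a • extMap 𝔤 f h := by
  induction h with
  | zero => simp
  | tmul b v => simp [TensorProduct.smul_tmul']
  | add x y hx hy => simp [smul_add, hx, hy]

theorem extMap_extMap (g : B →ₐ[k] C) (f : A →ₐ[k] B) (h : A ⊗[k] 𝔤) :
    extMap 𝔤 g (extMap 𝔤 f h) = extMap 𝔤 (g.comp f) h := by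
  induction h with
  | zero => simp
  | tmul b v => simp
  | add x y hx hy => simp [hx, hy]

variable {ι : Type*} (b : Module.Basis ι k 𝔤)

theorem repr_extMap (f : A →ₐ[k] B) (h : A ⊗[k] 𝔤) (i : ι) :
    (Algebra.TensorProduct.basis B b).repr (extMap 𝔤 f h) i =
      f ((Algebra.TensorProduct.basis A b).repr h i) := by
  induction h with
  | zero => simp
  | tmul a v => simp [Algebra.TensorProduct.basis_repr_tmul]
  | add x y hx hy => simp [hx, hy]

theorem mem_range_extMap [Finite ι] (f : A →ₐ[k] B) (h : B ⊗[k] 𝔤) :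
    h ∈ Set.range (extMap 𝔤 f) ↔
      ∀ i, (Algebra.TensorProduct.basis B b).repr h i ∈ Set.range f := by
  cases nonempty_fintype ι
  constructor
  · rintro ⟨h, rfl⟩ i
    exact ⟨_, (repr_extMap b f h i).symm⟩
  · intro hi
    choose a ha using hi
    refine ⟨∑ i, a i ⊗ₜ b i, ?_⟩
    conv_rhs => rw [← (Algebra.TensorProduct.basis B b).sum_repr h]
    simp [ha, TensorProduct.smul_tmul']

end ExtMap

/-! ### Weight bases and the adjoint action of the torus. -/

section Weights

variable {k 𝔤 : Type*} [Field k] [LieRing 𝔤] [LieAlgebra k 𝔤]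
  [FiniteDimensional k 𝔤] (H : LieSubalgebra k 𝔤) [H.IsCartanSubalgebra]

open LieModule

theorem exists_weight_basis [IsAlgClosed k] : ∃ (m : ℕ) (b : Module.Basis (Fin m) k 𝔤)
    (wt : Fin m → Weight k H 𝔤), ∀ i, b i ∈ weightSpaceOf H (wt i) := by
  classical
  have hI : DirectSum.IsInternal (weightSpaceOf H) := isInternal_weightSpaceOf H
  let b := hI.collectedBasis fun χ => Module.Basis.ofVectorSpace k (weightSpaceOf H χ)
  have := Module.Finite.finite_basis b
  let e := Finite.equivFin (Σ χ, Module.Basis.ofVectorSpaceIndex k (weightSpaceOf H χ))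
  refine ⟨_, b.reindex e, fun i => (e.symm i).1, fun i => ?_⟩
  rw [Module.Basis.reindex_apply]
  exact hI.collectedBasis_mem _ _

variable [CharZero k] {H} {ι : Type*} [Finite ι] {b : Module.Basis ι k 𝔤} {wt : ι → Weight k H 𝔤}
  {A : Type*} [CommRing A] [Algebra k A]

theorem repr_Ad [IsAlgClosed k] (hb : ∀ i, b i ∈ weightSpaceOf H (wt i)) (t : AdjointTorus H A)
    (h : A ⊗[k] 𝔤) (i : ι) :
    (Algebra.TensorProduct.basis A b).repr (Ad H t h) i =
      (t (Multiplicative.ofAdd (weightChar H (wt i))) : A) *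
        (Algebra.TensorProduct.basis A b).repr h i := by
  cases nonempty_fintype ι
  have key : (Algebra.TensorProduct.basis A b).coord i ∘ₗ Ad H t =
      (t (Multiplicative.ofAdd (weightChar H (wt i))) : A) •
        (Algebra.TensorProduct.basis A b).coord i := by
    classical
    refine (Algebra.TensorProduct.basis A b).ext fun j => ?_
    simp only [LinearMap.comp_apply, Algebra.TensorProduct.basis_apply, Ad_tmul H t (wt j) (hb j),
      LinearMap.smul_apply, Module.Basis.coord_apply, Algebra.TensorProduct.basis_repr_tmul]
    by_cases h : j = i
    · subst h; simp
    · simp [h]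
  exact LinearMap.congr_fun key h

/-- A `Weight` must have a nonzero weight space, so the sum of two weights is one only when
something, here the bracket, witnesses it. -/
theorem lie_mem_weightSpaceOf {χ ψ : Weight k H 𝔤} {x y : 𝔤} (hx : x ∈ weightSpaceOf H χ)
    (hy : y ∈ weightSpaceOf H ψ) (hne : ⁅x, y⁆ ≠ 0) :
    ∃ ω : Weight k H 𝔤, ⁅x, y⁆ ∈ weightSpaceOf H ω ∧
      weightChar H ω = weightChar H χ + weightChar H ψ := by
  have h : ⁅x, y⁆ ∈ genWeightSpace 𝔤 ((χ : H → k) + (ψ : H → k)) :=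
    LieAlgebra.lie_mem_genWeightSpace_of_mem_genWeightSpace hx hy
  refine ⟨⟨(χ : H → k) + (ψ : H → k), fun h0 => hne (by simpa [h0] using h)⟩, h, ?_⟩
  ext
  rfl

/-- Both sides are bilinear over `A`, so weight vectors suffice; there the weights add under the
bracket and `t` is multiplicative on characters. -/
theorem Ad_lie [IsAlgClosed k] (t : AdjointTorus H A) (x y : A ⊗[k] 𝔤) :
    Ad H t ⁅x, y⁆ = ⁅Ad H t x, Ad H t y⁆ := by
  obtain ⟨m, b, wt, hb⟩ := exists_weight_basis (k := k) H
  have key : ∀ i j, Ad H t ⁅(1 : A) ⊗ₜ[k] b i, (1 : A) ⊗ₜ[k] b j⁆ =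
      ⁅Ad H t ((1 : A) ⊗ₜ[k] b i), Ad H t ((1 : A) ⊗ₜ[k] b j)⁆ := by
    intro i j
    rw [Ad_tmul H t _ (hb i), Ad_tmul H t _ (hb j)]
    simp only [LieAlgebra.ExtendScalars.bracket_tmul, mul_one]
    by_cases h0 : ⁅b i, b j⁆ = 0
    · simp [h0]
    · obtain ⟨ω, hω, hω'⟩ := lie_mem_weightSpaceOf (hb i) (hb j) h0
      rw [Ad_tmul H t _ hω, hω', ofAdd_add, map_mul]
      simp
  rw [← (Algebra.TensorProduct.basis A b).sum_repr x, ← (Algebra.TensorProduct.basis A b).sum_repr y]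
  simp only [_root_.sum_lie_sum, map_sum, map_smul, smul_lie, lie_smul,
    Algebra.TensorProduct.basis_apply, key]

end Weights

/-! ### Laurent monomials and clearing denominators. -/

section VarMonomial

variable {P : Type*} [CommRing P] {n : ℕ} (x : Fin n → P)

/-- The Laurent monomial `∏ xᵢ ^ aᵢ` as a unit of the localization away from `∏ xᵢ`. -/
def varMonomial (a : Fin n → ℤ) : (Localization.Away (∏ i, x i))ˣ :=
  ∏ i, varUnit x i ^ a i

theorem coe_varUnit (i : Fin n) :
    (varUnit x i : Localization.Away (∏ i, x i)) = algebraMap P _ (x i) := rfl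

theorem varMonomial_add (a b : Fin n → ℤ) :
    varMonomial x (a + b) = varMonomial x a * varMonomial x b := by
  simp [varMonomial, zpow_add, Finset.prod_mul_distrib]

theorem coe_varMonomial_natCast (e : Fin n → ℕ) :
    (varMonomial x (fun i => (e i : ℤ)) : Localization.Away (∏ i, x i)) =
      algebraMap P _ (∏ i, x i ^ e i) := by
  simp [varMonomial, coe_varUnit]

theorem map_varMonomial {A : Type*} [CommRing A] (f : Localization.Away (∏ i, x i) →* A)
    (a : Fin n → ℤ) :
    Units.map f (varMonomial x a) = ∏ i, Units.map f (varUnit x i) ^ a i := by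
  simp [varMonomial]

theorem exists_mul_pow_eq_algebraMap (q : Localization.Away (∏ i, x i)) :
    ∃ (N : ℕ) (p : P), q * algebraMap P _ (∏ i, x i ^ N) = algebraMap P _ p := by
  obtain ⟨N, p, h⟩ := IsLocalization.Away.surj (∏ i, x i) q
  exact ⟨N, p, by rw [Finset.prod_pow, map_pow, h]⟩

theorem algebraMap_away_injective (h : ∀ i, x i ∈ nonZeroDivisors P) :
    Function.Injective (algebraMap P (Localization.Away (∏ i, x i))) :=
  IsLocalization.injective (M := Submonoid.powers (∏ i, x i)) _ (Submonoid.powers_le.mpr (prod_mem fun i _ => h i))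

theorem eq_algebraMap_of_mul_pow (q : Localization.Away (∏ i, x i)) (N : ℕ) (p : P)
    (h : q * algebraMap P _ (∏ i, x i ^ N) = algebraMap P _ ((∏ i, x i ^ N) * p)) :
    q = algebraMap P _ p := by
  have hu : IsUnit (algebraMap P (Localization.Away (∏ i, x i)) (∏ i, x i ^ N)) := by
    rw [← coe_varMonomial_natCast x fun _ => N]
    exact Units.isUnit _
  rw [map_mul, mul_comm] at h
  exact hu.mul_left_cancel h

theorem unit_map_mul_mem_range_iff {A B F : Type*} [CommRing A] [CommRing B] [FunLike F A B]
    [RingHomClass F A B] (f : F) (u : Aˣ) (b : B) : f u * b ∈ Set.range f ↔ b ∈ Set.range f := by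
  constructor
  · rintro ⟨a, ha⟩
    refine ⟨↑u⁻¹ * a, ?_⟩
    rw [map_mul, ha, ← mul_assoc, ← map_mul]
    simp
  · rintro ⟨a, rfl⟩
    exact ⟨u * a, map_mul _ _ _⟩

end VarMonomial

/-! ### Division with remainder on exponents. -/

section Exponents

theorem exists_nat_eq_add_mul_neg_ediv {n : ℕ} {d : ℕ} (hd : 0 < d) (m : Fin n → ℤ) :
    ∃ e : Fin n → ℕ, (∀ i, e i < d) ∧
      m + (fun i => (d : ℤ) * -(m i / d)) = fun i => (e i : ℤ) := by
  have hd' : (0 : ℤ) < d := by exact_mod_cast hd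
  refine ⟨fun i => (m i % d).toNat, fun i => ?_, ?_⟩
  · have := Int.emod_lt_of_pos (m i) hd'
    have := Int.emod_nonneg (m i) hd'.ne'
    dsimp only
    omega
  · funext i
    have := Int.emod_nonneg (m i) hd'.ne'
    have h := Int.emod_add_mul_ediv (m i) d
    simp only [Pi.add_apply, Int.toNat_of_nonneg this]
    linarith

/-- If `m i < N i`, then `d * N i` exceeds `d * m i` by at least `d`, which is more than `e i`. -/
theorem const_le_of_smul_le_add {n : ℕ} {d : ℕ} {e m N : Fin n →₀ ℕ}
    (he : ∀ i, e i < d) (h : d • N ≤ e + d • m) : N ≤ m := by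
  intro i
  have h1 := h i
  have h2 := he i
  simp only [Finsupp.smul_apply, Finsupp.add_apply, smul_eq_mul] at h1
  by_contra! hlt
  have : d * (m i + 1) ≤ d * N i := Nat.mul_le_mul_left _ hlt
  rw [mul_add] at this
  omega

end Exponents

/-! ### Regularity after the cover `x = y^d`. -/

section RootCover

variable {k : Type*} [Field k] {n : ℕ}

theorem prod_X_pow_eq_monomial (e : Fin n → ℕ) :
    (∏ i, MvPolynomial.X i ^ e i : MvPolynomial (Fin n) k) =
      MvPolynomial.monomial (Finsupp.equivFunOnFinite.symm e) 1 := by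
  rw [MvPolynomial.monic_monomial_eq, Finsupp.prod_fintype _ _ (by simp)]
  simp

theorem rootCover_algebraMap (d : ℕ) (p : MvPolynomial (Fin n) k) :
    rootCover n k d (algebraMap _ _ p) = algebraMap _ _ (MvPolynomial.expand d p) := by
  rw [rootCover, awayLift_algebraMap]
  have : (MvPolynomial.aeval fun i => algebraMap (MvPolynomial (Fin n) k) (MvLaurentPoly n k)
      (MvPolynomial.X i) ^ d) = (IsScalarTower.toAlgHom k (MvPolynomial (Fin n) k)
        (MvLaurentPoly n k)).comp (MvPolynomial.expand d) := by
    ext i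
    simp
  rw [this]
  rfl

theorem rootCover_varMonomial (d : ℕ) (a : Fin n → ℤ) :
    rootCover n k d (varMonomial MvPolynomial.X a).val =
      (varMonomial MvPolynomial.X fun i => (d : ℤ) * a i).val := by
  have h : ∀ i : Fin n, Units.map (rootCover n k d : MvLaurentPoly n k →* MvLaurentPoly n k)
      (varUnit MvPolynomial.X i) = varUnit MvPolynomial.X i ^ d := by
    intro i
    ext
    simp [coe_varUnit, rootCover_algebraMap]
  have := congrArg Units.val (map_varMonomial (MvPolynomial.X : Fin n → MvPolynomial (Fin n) k)
    (rootCover n k d : MvLaurentPoly n k →* MvLaurentPoly n k) a)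
  simp only [h] at this
  have e : (varMonomial (MvPolynomial.X : Fin n → MvPolynomial (Fin n) k) fun i => (d : ℤ) * a i) =
      ∏ i, (varUnit MvPolynomial.X i ^ d) ^ a i := by
    simp [varMonomial, zpow_mul]
  rw [e]
  exact this

theorem algebraMap_laurentPoly_injective :
    Function.Injective (algebraMap (MvPolynomial (Fin n) k) (MvLaurentPoly n k)) :=
  algebraMap_away_injective _ fun i => mem_nonZeroDivisors_of_ne_zero (MvPolynomial.X_ne_zero i)

theorem monomial_dvd_of_le (N : Fin n →₀ ℕ) (p : MvPolynomial (Fin n) k)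
    (h : ∀ m, MvPolynomial.coeff m p ≠ 0 → N ≤ m) : MvPolynomial.monomial N 1 ∣ p := by
  rw [MvPolynomial.monomial_one_dvd_iff_modMonomial_eq_zero]
  ext m
  by_cases hm : N ≤ m
  · rw [MvPolynomial.coeff_modMonomial_of_le _ hm, MvPolynomial.coeff_zero]
  · rw [MvPolynomial.coeff_modMonomial_of_not_le _ hm, MvPolynomial.coeff_zero]
    by_contra h0
    exact hm (h m h0)

/-- With `q = p / x^N`, the hypothesis reads `y^e p(y^d) = p' y^(dN)`. A monomial `x^m` of `p`
contributes to the exponent `e + d m`, which must be at least `d N`; hence `m ≥ N` and `x^N` divides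
`p`. -/
theorem monomial_mul_rootCover_mem_range_iff {d : ℕ} (hd : 0 < d) {e : Fin n → ℕ}
    (he : ∀ i, e i < d) (q : MvLaurentPoly n k) :
    algebraMap (MvPolynomial (Fin n) k) _ (∏ i, MvPolynomial.X i ^ e i) * rootCover n k d q ∈
        Set.range (algebraMap (MvPolynomial (Fin n) k) (MvLaurentPoly n k)) ↔
      q ∈ Set.range (algebraMap (MvPolynomial (Fin n) k) (MvLaurentPoly n k)) := by
  constructor
  · rintro ⟨p', hp'⟩
    obtain ⟨N, p, hp⟩ := exists_mul_pow_eq_algebraMap _ q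
    have h1 : (∏ i, MvPolynomial.X i ^ e i) * MvPolynomial.expand d p =
        p' * MvPolynomial.expand d (∏ i, MvPolynomial.X i ^ N) := by
      apply algebraMap_laurentPoly_injective
      rw [map_mul, map_mul, hp', ← rootCover_algebraMap, ← rootCover_algebraMap, ← hp, map_mul,
        mul_assoc]
    rw [prod_X_pow_eq_monomial, prod_X_pow_eq_monomial, MvPolynomial.expand_monomial] at h1
    obtain ⟨p'', hp''⟩ := monomial_dvd_of_le (Finsupp.equivFunOnFinite.symm fun _ => N) p (by
      intro m hm
      apply const_le_of_smul_le_add (d := d) (e := Finsupp.equivFunOnFinite.symm e) he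
      by_contra hlt
      have := congrArg (MvPolynomial.coeff (Finsupp.equivFunOnFinite.symm e + d • m)) h1
      rw [MvPolynomial.coeff_monomial_mul, MvPolynomial.coeff_expand_smul _ hd.ne',
        MvPolynomial.coeff_mul_monomial', if_neg hlt, one_mul] at this
      exact hm this)
    refine ⟨p'', (eq_algebraMap_of_mul_pow _ q N p'' ?_).symm⟩
    rw [hp, hp'', prod_X_pow_eq_monomial]
  · rintro ⟨p, rfl⟩
    exact ⟨_, by rw [rootCover_algebraMap, ← map_mul]⟩

/-- The part of `y^m` whose exponents are multiples of `d` is itself pulled back from `x`, so it can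
be moved into `q`; only the remainder `e` is left outside. -/
theorem varMonomial_mul_rootCover_mem_range_iff {d : ℕ} (hd : 0 < d) (m : Fin n → ℤ)
    (q : MvLaurentPoly n k) :
    (varMonomial MvPolynomial.X m).val * rootCover n k d q ∈
        Set.range (algebraMap (MvPolynomial (Fin n) k) (MvLaurentPoly n k)) ↔
      ((varMonomial MvPolynomial.X fun i => -(m i / d))⁻¹).val * q ∈
        Set.range (algebraMap (MvPolynomial (Fin n) k) (MvLaurentPoly n k)) := by
  obtain ⟨e, he, hme⟩ := exists_nat_eq_add_mul_neg_ediv hd m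
  rw [← monomial_mul_rootCover_mem_range_iff hd he (((varMonomial _ _)⁻¹).val * q), ← coe_varMonomial_natCast, ← hme,
    varMonomial_add, Units.val_mul, ← rootCover_varMonomial, mul_assoc, ← map_mul,
    Units.mul_inv_cancel_left]

end RootCover

/-! ### Integrality of rotated loops. -/

section Series

variable {k : Type*} [CommRing k] {n : ℕ} {R : Type*} [CommRing R] [Algebra k R]

theorem seriesProd_X_pow_eq_monomial (e : Fin n → ℕ) :
    (∏ i, MvPowerSeries.X i ^ e i : MvPowerSeries (Fin n) R) =
      MvPowerSeries.monomial (Finsupp.equivFunOnFinite.symm e) 1 := by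
  rw [MvPowerSeries.monomial_one_eq, Finsupp.prod_fintype _ _ (by simp)]
  simp

/-- No domain hypothesis on `R` is needed: the variables are never zero divisors in `R⟦z⟧`. -/
theorem algebraMap_laurentSeries_injective (n : ℕ) (R : Type*) [CommRing R] :
    Function.Injective (algebraMap (MvPowerSeries (Fin n) R) (MvLaurentSeries n R)) :=
  algebraMap_away_injective _ fun _ => MvPowerSeries.X_mem_nonzeroDivisors

theorem series_monomial_dvd_of_le (N : Fin n →₀ ℕ) (f : MvPowerSeries (Fin n) R)
    (h : ∀ m, MvPowerSeries.coeff m f ≠ 0 → N ≤ m) : MvPowerSeries.monomial N 1 ∣ f := by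
  let g : MvPowerSeries (Fin n) R := fun m => MvPowerSeries.coeff (N + m) f
  have hg : ∀ m, MvPowerSeries.coeff m g = MvPowerSeries.coeff (N + m) f := fun _ => rfl
  refine ⟨g, ?_⟩
  ext m
  rw [MvPowerSeries.coeff_monomial_mul]
  split_ifs with hm
  · rw [one_mul, hg, add_tsub_cancel_of_le hm]
  · by_contra h0
    exact hm (h m h0)

theorem seriesMap_algebraMap {R' : Type*} [CommRing R'] [Algebra k R'] (φ : R →ₐ[k] R')
    (f : MvPowerSeries (Fin n) R) :
    seriesMap φ (algebraMap _ (MvLaurentSeries n R) f) =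
      algebraMap _ (MvLaurentSeries n R') (MvPowerSeries.map (φ : R →+* R') f) :=
  awayLift_algebraMap _ _ _ f

theorem seriesMap_varUnit {R' : Type*} [CommRing R'] [Algebra k R'] (φ : R →ₐ[k] R')
    (i : Fin n) :
    Units.map (seriesMap (n := n) φ : MvLaurentSeries n R →* MvLaurentSeries n R')
      (varUnit MvPowerSeries.X i) = varUnit MvPowerSeries.X i := by
  ext
  simp [coe_varUnit, seriesMap_algebraMap]

theorem seriesMap_varMonomial {R' : Type*} [CommRing R'] [Algebra k R'] (φ : R →ₐ[k] R')
    (a : Fin n → ℤ) :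
    seriesMap φ (varMonomial MvPowerSeries.X a).val = (varMonomial MvPowerSeries.X a).val := by
  have := congrArg Units.val (map_varMonomial (MvPowerSeries.X : Fin n → MvPowerSeries (Fin n) R)
    (seriesMap (n := n) φ : MvLaurentSeries n R →* MvLaurentSeries n R') a)
  simp only [seriesMap_varUnit] at this
  exact this

/-- The loop `h(z) ↦ h(w ^ d z)`. -/
def loopPullback (k : Type*) [CommRing k] (n : ℕ) (R : Type*) [CommRing R] [Algebra k R] (d : ℕ) :
    MvLaurentSeries n R →ₐ[k] MvLaurentSeries n (MvLaurentSeries n R) :=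
  (loopRotation (k := k) fun i => varUnit MvPowerSeries.X i ^ d).comp
    (seriesMap (IsScalarTower.toAlgHom k R (MvLaurentSeries n R)))

theorem loopRotation_algebraMap (u : Fin n → Rˣ) (f : MvPowerSeries (Fin n) R) :
    loopRotation (k := k) u (algebraMap _ (MvLaurentSeries n R) f) =
      algebraMap _ (MvLaurentSeries n R) (MvPowerSeries.rescale (fun i => (u i : R)) f) := by
  rw [loopRotation, awayLift_algebraMap]
  simp only [AlgHom.restrictScalars_apply, AlgHom.comp_apply, MvPowerSeries.rescaleAlgHom_apply]
  rfl

theorem algebraMap_laurentSeries_eq_C (x : R) :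
    algebraMap R (MvLaurentSeries n R) x =
      algebraMap (MvPowerSeries (Fin n) R) _ (MvPowerSeries.C x) := rfl

theorem loopPullback_algebraMap (d : ℕ) (f : MvPowerSeries (Fin n) R) :
    loopPullback k n R d (algebraMap _ (MvLaurentSeries n R) f) =
      algebraMap _ _ (MvPowerSeries.rescale
        (fun i => algebraMap (MvPowerSeries (Fin n) R) (MvLaurentSeries n R) (MvPowerSeries.X i ^ d))
        (MvPowerSeries.map (algebraMap R (MvLaurentSeries n R)) f)) := by
  rw [loopPullback, AlgHom.comp_apply, seriesMap_algebraMap, loopRotation_algebraMap]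
  simp only [Units.val_pow_eq_pow_val, coe_varUnit, map_pow]
  rfl

theorem coeff_rescale_map (d : ℕ) (f : MvPowerSeries (Fin n) R) (m : Fin n →₀ ℕ) :
    MvPowerSeries.coeff m (MvPowerSeries.rescale
        (fun i => algebraMap (MvPowerSeries (Fin n) R) (MvLaurentSeries n R) (MvPowerSeries.X i ^ d))
        (MvPowerSeries.map (algebraMap R (MvLaurentSeries n R)) f)) =
      algebraMap (MvPowerSeries (Fin n) R) (MvLaurentSeries n R)
        (MvPowerSeries.monomial (d • m) (MvPowerSeries.coeff m f)) := by
  rw [MvPowerSeries.coeff_rescale, MvPowerSeries.coeff_map, MvPowerSeries.monomial_smul_eq, map_mul,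
    mul_comm]
  congr 1
  rw [map_finsuppProd]
  simp

theorem rescale_map_monomial (d : ℕ) (N : Fin n →₀ ℕ) :
    MvPowerSeries.rescale
        (fun i => algebraMap (MvPowerSeries (Fin n) R) (MvLaurentSeries n R) (MvPowerSeries.X i ^ d))
        (MvPowerSeries.map (algebraMap R (MvLaurentSeries n R)) (MvPowerSeries.monomial N 1)) =
      MvPowerSeries.monomial N (algebraMap (MvPowerSeries (Fin n) R) (MvLaurentSeries n R)
        (MvPowerSeries.monomial (d • N) 1)) := by
  classical
  ext m
  rw [coeff_rescale_map, MvPowerSeries.coeff_monomial, MvPowerSeries.coeff_monomial]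
  split_ifs with h
  · rw [h]
  · simp

theorem loopPullback_varMonomial (d : ℕ) (a : Fin n → ℤ) :
    loopPullback k n R d (varMonomial MvPowerSeries.X a).val =
      algebraMap (MvLaurentSeries n R) _
          (varMonomial MvPowerSeries.X fun i => (d : ℤ) * a i).val *
        (varMonomial MvPowerSeries.X a).val := by
  have h : ∀ i : Fin n, Units.map
      (loopPullback k n R d : MvLaurentSeries n R →* MvLaurentSeries n (MvLaurentSeries n R))
      (varUnit MvPowerSeries.X i) =
        Units.map (algebraMap (MvLaurentSeries n R) (MvLaurentSeries n (MvLaurentSeries n R)) :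
          MvLaurentSeries n R →* MvLaurentSeries n (MvLaurentSeries n R))
            (varUnit MvPowerSeries.X i) ^ d * varUnit MvPowerSeries.X i := by
    intro i
    ext
    simp only [Units.coe_map, coe_varUnit, MonoidHom.coe_coe, loopPullback_algebraMap,
      MvPowerSeries.map_X, rescale_X, map_mul, Units.val_mul, Units.val_pow_eq_pow_val]
    rw [algebraMap_laurentSeries_eq_C, map_pow, map_pow, map_pow]
  have := congrArg Units.val (map_varMonomial (MvPowerSeries.X : Fin n → MvPowerSeries (Fin n) R)
    (loopPullback k n R d : MvLaurentSeries n R →* MvLaurentSeries n (MvLaurentSeries n R)) a)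
  have e : (varMonomial (MvPowerSeries.X : Fin n → MvPowerSeries (Fin n) R)
      fun i => (d : ℤ) * a i) = ∏ i, (varUnit MvPowerSeries.X i ^ d) ^ a i := by
    simp [varMonomial, zpow_mul]
  simp only [h, mul_zpow, Finset.prod_mul_distrib] at this
  rw [e]
  refine this.trans ?_
  rw [Units.val_mul]
  refine congrArg (· * _) ?_
  simp only [← map_pow, ← map_zpow, ← map_prod]
  rfl

/-- Rotation puts `w^(d m)` on the coefficient of `z^m`. Poles in `z` remain allowed in the target
`R⟦w⟧((z))`, so it is integrality in `w` that forces `m ≥ 0`, as `e < d`. -/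
theorem monomial_mul_loopPullback_mem_range_iff {d : ℕ} {e : Fin n → ℕ}
    (he : ∀ i, e i < d) (q : MvLaurentSeries n R) :
    algebraMap (MvLaurentSeries n R) _ (algebraMap (MvPowerSeries (Fin n) R) _
        (∏ i, MvPowerSeries.X i ^ e i)) * loopPullback k n R d q ∈
        Set.range (seriesMap (n := n)
          (IsScalarTower.toAlgHom k (MvPowerSeries (Fin n) R) (MvLaurentSeries n R))) ↔
      q ∈ Set.range (algebraMap (MvPowerSeries (Fin n) R) (MvLaurentSeries n R)) := by
  constructor
  · rintro ⟨g, hg⟩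
    obtain ⟨N, f, hf⟩ := exists_mul_pow_eq_algebraMap _ q
    obtain ⟨M, g', hg'⟩ := exists_mul_pow_eq_algebraMap _ g
    replace hg' := congrArg (seriesMap (n := n)
      (IsScalarTower.toAlgHom k (MvPowerSeries (Fin n) R) (MvLaurentSeries n R))) hg'
    have hf₀ := hf
    replace hf := congrArg (loopPullback k n R d) hf
    rw [map_mul, hg, seriesMap_algebraMap, seriesMap_algebraMap] at hg'
    rw [map_mul, loopPullback_algebraMap, loopPullback_algebraMap] at hf
    -- An identity in `R((w))⟦z⟧`: `z^N` clears the poles of `q`, which costs `w^(dN) z^N` after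
    -- rotation, and `z^M` clears those of `g`.
    have key : MvPowerSeries.C (algebraMap (MvPowerSeries (Fin n) R) (MvLaurentSeries n R)
          (∏ i, MvPowerSeries.X i ^ e i)) * MvPowerSeries.rescale (fun i =>
            algebraMap (MvPowerSeries (Fin n) R) (MvLaurentSeries n R) (MvPowerSeries.X i ^ d))
              (MvPowerSeries.map (algebraMap R (MvLaurentSeries n R)) f) *
          MvPowerSeries.map (algebraMap (MvPowerSeries (Fin n) R) (MvLaurentSeries n R))
            (∏ i, MvPowerSeries.X i ^ M) =
        MvPowerSeries.map (algebraMap (MvPowerSeries (Fin n) R) (MvLaurentSeries n R)) g' *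
          MvPowerSeries.rescale (fun i =>
            algebraMap (MvPowerSeries (Fin n) R) (MvLaurentSeries n R) (MvPowerSeries.X i ^ d))
              (MvPowerSeries.map (algebraMap R (MvLaurentSeries n R))
                (∏ i, MvPowerSeries.X i ^ N)) := by
      apply algebraMap_laurentSeries_injective
      rw [map_mul, map_mul, map_mul, ← algebraMap_laurentSeries_eq_C, ← hf]
      refine Eq.trans ?_ (congrArg (· * _) hg')
      rw [mul_assoc, mul_assoc, mul_assoc, mul_assoc]
      refine congrArg _ ?_
      exact congrArg _ (mul_comm _ _)
    rw [seriesProd_X_pow_eq_monomial, seriesProd_X_pow_eq_monomial, seriesProd_X_pow_eq_monomial,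
      rescale_map_monomial, MvPowerSeries.map_monomial,
      (algebraMap (MvPowerSeries (Fin n) R) (MvLaurentSeries n R)).map_one] at key
    obtain ⟨f', rfl⟩ := series_monomial_dvd_of_le (Finsupp.equivFunOnFinite.symm fun _ => N) f (by
      intro m hm
      apply const_le_of_smul_le_add (d := d) (e := Finsupp.equivFunOnFinite.symm e) he
      by_contra hlt
      -- At `z^(m + M)` the left side is `w^(e + d m)` times the coefficient of `f`; the right side
      -- is either zero or a multiple of `w^(dN)` in `R⟦w⟧`. Since `dN ≰ e + d m`, the coefficient
      -- of `f` vanishes.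
      have h1 := congrArg (MvPowerSeries.coeff (m + Finsupp.equivFunOnFinite.symm fun _ => M)) key
      rw [MvPowerSeries.coeff_mul_monomial, if_pos le_add_self, add_tsub_cancel_right,
        MvPowerSeries.coeff_C_mul, coeff_rescale_map, mul_one, ← map_mul,
        MvPowerSeries.monomial_mul_monomial, one_mul, MvPowerSeries.coeff_mul_monomial,
        MvPowerSeries.coeff_map, ← map_mul] at h1
      obtain ⟨h, hh⟩ : ∃ h : MvPowerSeries (Fin n) R, MvPowerSeries.monomial
          (Finsupp.equivFunOnFinite.symm e + d • m) (MvPowerSeries.coeff m f) =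
            h * MvPowerSeries.monomial (d • Finsupp.equivFunOnFinite.symm fun _ => N) 1 := by
        split_ifs at h1
        · exact ⟨_, algebraMap_laurentSeries_injective n R h1⟩
        · exact ⟨0, algebraMap_laurentSeries_injective n R (by simpa using h1)⟩
      have := congrArg (MvPowerSeries.coeff (Finsupp.equivFunOnFinite.symm e + d • m)) hh
      rw [MvPowerSeries.coeff_monomial_same, MvPowerSeries.coeff_mul_monomial, if_neg hlt] at this
      exact hm this)
    refine ⟨f', (eq_algebraMap_of_mul_pow _ q N f' ?_).symm⟩
    rw [hf₀, seriesProd_X_pow_eq_monomial]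
  · rintro ⟨f, rfl⟩
    -- The series `w^e f(w^d z)`, formed with coefficients in `R⟦w⟧` from the start.
    refine ⟨algebraMap _ _ (MvPowerSeries.C (∏ i, MvPowerSeries.X i ^ e i) *
      MvPowerSeries.rescale (fun i => MvPowerSeries.X i ^ d)
        (MvPowerSeries.map MvPowerSeries.C f)), ?_⟩
    rw [seriesMap_algebraMap, loopPullback_algebraMap, algebraMap_laurentSeries_eq_C, ← map_mul]
    congr 1
    ext m
    rw [MvPowerSeries.coeff_map, MvPowerSeries.coeff_C_mul, MvPowerSeries.coeff_C_mul,
      coeff_rescale_map, MvPowerSeries.coeff_rescale, MvPowerSeries.coeff_map,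
      MvPowerSeries.monomial_smul_eq, mul_comm (MvPowerSeries.C _)]
    exact map_mul (algebraMap (MvPowerSeries (Fin n) R) (MvLaurentSeries n R)) _ _

theorem varMonomial_mul_loopPullback_mem_range_iff {d : ℕ} (hd : 0 < d) (m : Fin n → ℤ)
    (q : MvLaurentSeries n R) :
    algebraMap (MvLaurentSeries n R) _ (varMonomial MvPowerSeries.X m).val *
        loopPullback k n R d q ∈ Set.range (seriesMap (n := n)
          (IsScalarTower.toAlgHom k (MvPowerSeries (Fin n) R) (MvLaurentSeries n R))) ↔
      ((varMonomial MvPowerSeries.X fun i => -(m i / d))⁻¹).val * q ∈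
        Set.range (algebraMap (MvPowerSeries (Fin n) R) (MvLaurentSeries n R)) := by
  obtain ⟨e, he, hme⟩ := exists_nat_eq_add_mul_neg_ediv hd m
  set t := (varMonomial (MvPowerSeries.X : Fin n → MvPowerSeries (Fin n) R)
    fun i => -(m i / d)) with ht
  obtain ⟨q, rfl⟩ : ∃ q', q = t.val * q' := ⟨t⁻¹.val * q, by simp⟩
  rw [Units.inv_mul_cancel_left, ← monomial_mul_loopPullback_mem_range_iff (k := k) he,
    ← coe_varMonomial_natCast, ← hme, varMonomial_add, Units.val_mul, map_mul, map_mul, ht,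
    loopPullback_varMonomial]
  -- Rotating `z^a` gives `w^(da) z^a`. The surplus `z^a` is a unit already in `R⟦w⟧((z))`, so it
  -- does not affect membership.
  rw [← unit_map_mul_mem_range_iff (seriesMap (n := n)
    (IsScalarTower.toAlgHom k (MvPowerSeries (Fin n) R) (MvLaurentSeries n R)))
    (varMonomial MvPowerSeries.X fun i => -(m i / d)) (_ * _ * loopPullback k n R d q)]
  simp only [seriesMap_varMonomial]
  ring_nf

end Series

/-! ### Integrality of the pairing and independence of `d`. -/

section Cochar

variable {k 𝔤 : Type*} [Field k] [CharZero k] [LieRing 𝔤] [LieAlgebra k 𝔤]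
  [FiniteDimensional k 𝔤] [LieAlgebra.IsKilling k 𝔤] {H : LieSubalgebra k 𝔤}
  [H.IsCartanSubalgebra]

open LieModule

theorem exists_intCast_eq_of_mem_lattices [IsAlgClosed k] {r : Module.Dual k H} (hr : r ∈ rootLattice (𝔤 := 𝔤) H)
    {h : H} (hh : h ∈ cocharLattice H) : ∃ z : ℤ, r h = z := by
  induction hr using AddSubgroup.closure_induction with
  | mem r hr =>
    obtain ⟨χ, rfl⟩ := hr
    induction hh using AddSubgroup.closure_induction with
    | mem h hh =>
      obtain ⟨α, rfl⟩ := hh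
      -- On generators the pairing is read off from the `α`-string through `χ`.
      exact ⟨chainBotCoeff α χ - chainTopCoeff α χ,
        by simpa using LieAlgebra.IsKilling.apply_coroot_eq_cast α χ⟩
    | zero => exact ⟨0, by simp⟩
    | add x y _ _ hx hy =>
      obtain ⟨a, ha⟩ := hx
      obtain ⟨b, hb⟩ := hy
      exact ⟨a + b, by rw [map_add, ha, hb]; push_cast; rfl⟩
    | neg x _ hx =>
      obtain ⟨a, ha⟩ := hx
      exact ⟨-a, by rw [map_neg, ha]; push_cast; rfl⟩
  | zero => exact ⟨0, by simp⟩
  | add x y _ _ hx hy =>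
    obtain ⟨a, ha⟩ := hx
    obtain ⟨b, hb⟩ := hy
    exact ⟨a + b, by rw [LinearMap.add_apply, ha, hb]; push_cast; rfl⟩
  | neg x _ hx =>
    obtain ⟨a, ha⟩ := hx
    exact ⟨-a, by rw [LinearMap.neg_apply, ha]; push_cast; rfl⟩

theorem exists_isMultiple [IsAlgClosed k] {n : ℕ} (θ : Fin n → apartment H) :
    ∃ d : ℕ, 0 < d ∧ ∃ μ : Fin n → AdjointCochar H, IsMultiple d θ μ := by
  choose N hN hmem using fun i => (θ i).2
  refine ⟨∏ i, N i, Finset.prod_pos fun i _ => hN i, ?_⟩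
  have hlat : ∀ i, (∏ i, N i) • (θ i : H) ∈ cocharLattice H := by
    intro i
    obtain ⟨c, hc⟩ := Finset.dvd_prod_of_mem N (Finset.mem_univ i)
    rw [hc, mul_comm, mul_smul]
    exact AddSubgroup.nsmul_mem _ (hmem i) c
  have hz : ∀ i (r : rootLattice H), ∃ z : ℤ,
      (z : k) = (∏ i, N i : ℕ) * (r : Module.Dual k H) (θ i : H) := by
    intro i r
    obtain ⟨z, hz⟩ := exists_intCast_eq_of_mem_lattices r.2 (hlat i)
    exact ⟨z, by rw [← hz, map_nsmul, nsmul_eq_mul]⟩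
  choose μ hμ using hz
  refine ⟨fun i => AddMonoidHom.mk' (μ i) fun r s => ?_, fun i r => hμ i r⟩
  apply Int.cast_injective (α := k)
  rw [Int.cast_add, hμ, hμ, hμ, AddSubgroup.coe_add, LinearMap.add_apply, mul_add]

/-- Both quotients are the floor of the same rational number `r(θ i)`: cross-multiplying gives `d' μ
= d μ'`. -/
theorem IsMultiple.ediv_eq {n : ℕ} {θ : Fin n → apartment H} {d d' : ℕ} (hd : 0 < d) (hd' : 0 < d')
    {μ μ' : Fin n → AdjointCochar H} (h : IsMultiple d θ μ) (h' : IsMultiple d' θ μ') (i : Fin n)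
    (r : rootLattice H) : μ i r / d = μ' i r / d' := by
  have key : (d' : ℤ) * μ i r = d * μ' i r := by
    apply Int.cast_injective (α := k)
    push_cast
    rw [h i r, h' i r]
    ring
  rw [← Int.mul_ediv_mul_of_pos (μ i r) d (Int.natCast_pos.mpr hd'), key, mul_comm (d' : ℤ),
    Int.mul_ediv_mul_of_pos _ _ (Int.natCast_pos.mpr hd)]

end Cochar

/-! ### Bases rescaled by monomials. -/

section Bases

variable {k 𝔤 : Type*} [Field k] [LieRing 𝔤] [LieAlgebra k 𝔤]

/-- The basis `∏ xⱼ ^ aᵢⱼ ⊗ bᵢ` of `𝔤(P[x⁻¹])`. -/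
def scaledBasis {P : Type*} [CommRing P] [Algebra k P] {n : ℕ} {ι : Type*} (x : Fin n → P)
    (b : Module.Basis ι k 𝔤) (a : ι → Fin n → ℤ) :
    Module.Basis ι (Localization.Away (∏ i, x i)) (Localization.Away (∏ i, x i) ⊗[k] 𝔤) :=
  (Algebra.TensorProduct.basis _ b).unitsSMul fun i => varMonomial x (a i)

variable {P : Type*} [CommRing P] [Algebra k P] {n : ℕ} {ι : Type*} (x : Fin n → P)
    (b : Module.Basis ι k 𝔤) (a : ι → Fin n → ℤ)

theorem scaledBasis_apply (i : ι) : scaledBasis x b a i = (varMonomial x (a i)).val ⊗ₜ b i := by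
  rw [scaledBasis, Module.Basis.unitsSMul_apply, Algebra.TensorProduct.basis_apply,
    Units.smul_def, TensorProduct.smul_tmul', smul_eq_mul, mul_one]

theorem scaledBasis_repr (h : Localization.Away (∏ i, x i) ⊗[k] 𝔤) (i : ι) :
    (scaledBasis x b a).repr h i = (varMonomial x (a i))⁻¹.val *
      (Algebra.TensorProduct.basis _ b).repr h i := by
  rw [scaledBasis, Module.Basis.repr_unitsSMul, Units.smul_def, smul_eq_mul]

end Bases

/-! ### The canonical comparison maps. -/

section Maps

/-- Of the action of `A` on `N` only `hN` is asked, so that the lemma applies at both stages of a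
nested base change, where `k⟦z⟧` acts through `R⟦z⟧`. -/
theorem map_lie_of_map_one_tmul_lie {P A L N : Type*} [CommRing P] [CommRing A] [Algebra P A]
    [LieRing L] [LieAlgebra P L] [LieRing N] [Module A N]
    (hN : ∀ (a : A) (x y : N), ⁅x, a • y⁆ = a • ⁅x, y⁆) (f : A ⊗[P] L →ₗ[A] N)
    (h : ∀ l l' : L, f ((1 : A) ⊗ₜ ⁅l, l'⁆) = ⁅f (1 ⊗ₜ l), f (1 ⊗ₜ l')⁆) (x y : A ⊗[P] L) :
    f ⁅x, y⁆ = ⁅f x, f y⁆ := by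
  have hN' (a : A) (x y : N) : ⁅a • x, y⁆ = a • ⁅x, y⁆ := by
    rw [← lie_skew, hN, ← smul_neg, lie_skew]
  have hf (a : A) (l : L) : f (a ⊗ₜ l) = a • f (1 ⊗ₜ l) := by
    rw [← map_smul, TensorProduct.smul_tmul', smul_eq_mul, mul_one]
  induction x with
  | zero => rw [zero_lie, map_zero, zero_lie]
  | add x x' hx hx' => rw [add_lie, map_add, map_add, add_lie, hx, hx']
  | tmul a l =>
    induction y with
    | zero => rw [lie_zero, map_zero, lie_zero]
    | add y y' hy hy' => rw [lie_add, map_add, map_add, lie_add, hy, hy']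
    | tmul b l' =>
      rw [LieAlgebra.ExtendScalars.bracket_tmul, hf, h, hf a, hf b, hN, hN', smul_smul, mul_comm]

variable {k 𝔤 : Type*} [Field k] [LieRing 𝔤] [LieAlgebra k 𝔤] {n : ℕ}
  {R : Type*} [CommRing R] [Algebra k R]

/-- This and the next instance make polynomials act on Laurent series over `R` through `k⟦z⟧`, as
the nested base change in `posLoopLinearMap` requires. -/
instance : IsScalarTower (MvPolynomial (Fin n) k) (MvPowerSeries (Fin n) k)
    (MvPowerSeries (Fin n) R) :=
  IsScalarTower.of_algebraMap_eq fun p => by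
    rw [MvPowerSeries.algebraMap_apply', MvPowerSeries.algebraMap_apply',
      MvPowerSeries.algebraMap_apply'']
    simp

instance : IsScalarTower (MvPolynomial (Fin n) k) (MvPowerSeries (Fin n) k)
    (MvLaurentSeries n R) :=
  IsScalarTower.of_algebraMap_eq fun p => by
    rw [IsScalarTower.algebraMap_apply _ (MvPowerSeries (Fin n) R),
      IsScalarTower.algebraMap_apply _ (MvPowerSeries (Fin n) k) (MvPowerSeries (Fin n) R),
      ← IsScalarTower.algebraMap_apply]

theorem expansion_algebraMap (p : MvPolynomial (Fin n) k) :
    expansion n k R (algebraMap _ _ p) = algebraMap _ (MvLaurentSeries n R) p := by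
  rw [expansion, awayLift_algebraMap,
    IsScalarTower.algebraMap_apply _ (MvPowerSeries (Fin n) R) (MvLaurentSeries n R)]
  induction p using MvPolynomial.induction_on with
  | C c =>
    rw [MvPolynomial.algHom_C, MvPowerSeries.algebraMap_apply', MvPolynomial.coe_C,
      MvPowerSeries.map_C, IsScalarTower.algebraMap_apply k (MvPowerSeries (Fin n) R),
      MvPowerSeries.algebraMap_apply]
  | add p q hp hq => simp only [map_add, hp, hq]
  | mul_X p i hp =>
    rw [map_mul, map_mul, map_mul, hp, MvPolynomial.aeval_X, MvPowerSeries.algebraMap_apply' R (.X i),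
      MvPolynomial.coe_X, MvPowerSeries.map_X]

theorem expansion_varMonomial (a : Fin n → ℤ) :
    expansion n k R (varMonomial MvPolynomial.X a).val = (varMonomial MvPowerSeries.X a).val := by
  have h : ∀ i : Fin n, Units.map
      (expansion n k R : MvLaurentPoly n k →* MvLaurentSeries n R) (varUnit MvPolynomial.X i) =
        varUnit MvPowerSeries.X i := by
    intro i
    ext
    simp only [Units.coe_map, coe_varUnit, MonoidHom.coe_coe]
    rw [expansion, awayLift_algebraMap, MvPolynomial.aeval_X]
  have := congrArg Units.val (map_varMonomial (MvPolynomial.X : Fin n → MvPolynomial (Fin n) k)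
    (expansion n k R : MvLaurentPoly n k →* MvLaurentSeries n R) a)
  simp only [h] at this
  exact this

theorem seriesMap_expansion {R' : Type*} [CommRing R'] [Algebra k R'] (φ : R →ₐ[k] R') :
    (seriesMap φ).comp (expansion n k R) = expansion n k R' := by
  apply AlgHom.coe_ringHom_injective
  refine IsLocalization.ringHom_ext
    (Submonoid.powers (∏ i : Fin n, (MvPolynomial.X i : MvPolynomial (Fin n) k))) ?_
  refine RingHom.ext fun p => ?_
  simp only [RingHom.comp_apply, RingHom.coe_coe, AlgHom.comp_apply]
  rw [expansion_algebraMap, expansion_algebraMap,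
    IsScalarTower.algebraMap_apply _ (MvPowerSeries (Fin n) R) (MvLaurentSeries n R),
    IsScalarTower.algebraMap_apply _ (MvPowerSeries (Fin n) R') (MvLaurentSeries n R'),
    seriesMap_algebraMap]
  congr 1
  ext m
  simp [MvPowerSeries.algebraMap_apply']

variable (ℛ : LieSubalgebra (MvPolynomial (Fin n) k) (MvLaurentPoly n k ⊗[k] 𝔤))

/-- The linear map underlying `localizationMap`. -/
def localizationLinearMap : (MvLaurentPoly n k ⊗[MvPolynomial (Fin n) k] ℛ)
    →ₗ[MvLaurentPoly n k] (MvLaurentPoly n k ⊗[k] 𝔤) :=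
  LinearMap.liftBaseChange (MvLaurentPoly n k)
    { toFun := fun m => (m : MvLaurentPoly n k ⊗[k] 𝔤)
      map_add' := fun _ _ => rfl
      map_smul' := fun _ _ => rfl }

theorem localizationLinearMap_tmul (b : MvLaurentPoly n k) (m : ℛ) :
    localizationLinearMap ℛ (b ⊗ₜ m) = b • (m : MvLaurentPoly n k ⊗[k] 𝔤) :=
  LinearMap.liftBaseChange_tmul _ _ _ _

/-- The canonical map `B₀ ⊗ ℛ → 𝔤(B₀)`. -/
def localizationMap : (MvLaurentPoly n k ⊗[MvPolynomial (Fin n) k] ℛ)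
    →ₗ⁅MvLaurentPoly n k⁆ (MvLaurentPoly n k ⊗[k] 𝔤) :=
  { localizationLinearMap ℛ with
    map_lie' {x y} := by
      refine map_lie_of_map_one_tmul_lie (fun a x y => LieAlgebra.lie_smul a x y)
        (localizationLinearMap ℛ) (fun l l' => ?_) x y
      rw [localizationLinearMap_tmul, localizationLinearMap_tmul, localizationLinearMap_tmul,
        one_smul, one_smul, one_smul]
      rfl }

theorem localizationMap_tmul (b : MvLaurentPoly n k) (m : ℛ) :
    localizationMap ℛ (b ⊗ₜ m) = b • (m : MvLaurentPoly n k ⊗[k] 𝔤) :=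
  localizationLinearMap_tmul ℛ b m

variable (R)

/-- The expansion at the origin of the sections of `ℛ`. -/
def expansionMap : ℛ →ₗ[MvPolynomial (Fin n) k] (MvLaurentSeries n R ⊗[k] 𝔤) where
  toFun m := extMap 𝔤 (expansion n k R) m
  map_add' x y := by simp
  map_smul' p x := by
    change extMap 𝔤 (expansion n k R) (p • (x : MvLaurentPoly n k ⊗[k] 𝔤)) = p • _
    rw [← algebraMap_smul (MvLaurentPoly n k) p, extMap_smul, expansion_algebraMap, algebraMap_smul]

/-- The linear map underlying `posLoopMap`. -/
def posLoopLinearMap : PosLoop n k (FormalNhd n k ℛ) R →ₗ[MvPowerSeries (Fin n) R]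
    (MvLaurentSeries n R ⊗[k] 𝔤) :=
  LinearMap.liftBaseChange (MvPowerSeries (Fin n) R)
    (LinearMap.liftBaseChange (MvPowerSeries (Fin n) k) (expansionMap R ℛ))

theorem posLoopLinearMap_tmul (f : MvPowerSeries (Fin n) R) (g : MvPowerSeries (Fin n) k) (m : ℛ) :
    posLoopLinearMap R ℛ (f ⊗ₜ (g ⊗ₜ m)) = (f * algebraMap _ (MvPowerSeries (Fin n) R) g) •
      extMap 𝔤 (expansion n k R) (m : MvLaurentPoly n k ⊗[k] 𝔤) := by
  rw [posLoopLinearMap, LinearMap.liftBaseChange_tmul, LinearMap.liftBaseChange_tmul, mul_smul,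
    algebraMap_smul]
  rfl

/-- The canonical map `Lₙ⁺(ℛ|_V)(R) → Lₙ𝔤(R)`. -/
def posLoopMap : PosLoop n k (FormalNhd n k ℛ) R →ₗ⁅MvPowerSeries (Fin n) R⁆
    (MvLaurentSeries n R ⊗[k] 𝔤) :=
  { posLoopLinearMap R ℛ with
    map_lie' {x y} := by
      refine map_lie_of_map_one_tmul_lie (fun a x y => lie_smul a x y) (posLoopLinearMap R ℛ) ?_ x y
      intro s s'
      simp only [posLoopLinearMap, LinearMap.liftBaseChange_tmul, one_smul]
      refine map_lie_of_map_one_tmul_lie (fun a x y => ?_) _ ?_ s s'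
      · rw [← algebraMap_smul (MvPowerSeries (Fin n) R) a, lie_smul, algebraMap_smul]
      · intro m m'
        simp only [LinearMap.liftBaseChange_tmul, one_smul]
        exact (extMap 𝔤 (expansion n k R)).map_lie _ _ }

theorem posLoopMap_tmul (f : MvPowerSeries (Fin n) R) (g : MvPowerSeries (Fin n) k) (m : ℛ) :
    posLoopMap R ℛ (f ⊗ₜ (g ⊗ₜ m)) = (f * algebraMap _ (MvPowerSeries (Fin n) R) g) •
      extMap 𝔤 (expansion n k R) (m : MvLaurentPoly n k ⊗[k] 𝔤) :=
  posLoopLinearMap_tmul R ℛ f g m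

theorem posLoopMap_natural {R' : Type*} [CommRing R'] [Algebra k R'] (φ : R →ₐ[k] R')
    (f : MvPowerSeries (Fin n) R) (s : FormalNhd n k ℛ) :
    posLoopMap R' ℛ (MvPowerSeries.map φ.toRingHom f ⊗ₜ s) =
      extMap 𝔤 (seriesMap φ) (posLoopMap R ℛ (f ⊗ₜ s)) := by
  induction s using TensorProduct.induction_on with
  | zero => simp
  | add x y hx hy => rw [TensorProduct.tmul_add, TensorProduct.tmul_add, map_add, map_add, map_add,
      hx, hy]
  | tmul g m =>
    have hg : MvPowerSeries.map φ.toRingHom (algebraMap _ (MvPowerSeries (Fin n) R) g) =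
        algebraMap _ (MvPowerSeries (Fin n) R') g := by
      ext m
      simp [MvPowerSeries.algebraMap_apply'']
    rw [posLoopMap_tmul, posLoopMap_tmul, ← algebraMap_smul (MvLaurentSeries n R) (f * _), extMap_smul,
      extMap_extMap, seriesMap_expansion, seriesMap_algebraMap,
      algebraMap_smul, ← hg, ← map_mul]
    rfl

end Maps

/-! ### The bundle, its basis, and the parahoric Lie algebra. -/

section Parahoric

variable {k 𝔤 : Type*} [Field k] [CharZero k] [LieRing 𝔤] [LieAlgebra k 𝔤]
  [FiniteDimensional k 𝔤] {H : LieSubalgebra k 𝔤}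
  [H.IsCartanSubalgebra] {n : ℕ}

open LieModule

/-- The least integer `≥ -⟨χ, θⱼ⟩`, where `μⱼ = d θⱼ`, for the weight `χ` of the `i`-th basis
vector. -/
def poleBound {ι : Type*} (wt : ι → Weight k H 𝔤) (d : ℕ) (μ : Fin n → AdjointCochar H) (i : ι)
    (j : Fin n) : ℤ :=
  -(μ j (weightChar H (wt i)) / d)

theorem poleBound_eq [LieAlgebra.IsKilling k 𝔤] {ι : Type*} (wt : ι → Weight k H 𝔤)
    {θ : Fin n → apartment H} {d d' : ℕ} (hd : 0 < d) (hd' : 0 < d')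
    {μ μ' : Fin n → AdjointCochar H} (h : IsMultiple d θ μ) (h' : IsMultiple d' θ μ') :
    poleBound wt d μ = poleBound wt d' μ' := by
  funext i j
  rw [poleBound, poleBound, h.ediv_eq hd hd' h']

variable [IsAlgClosed k]

theorem twist_lie (d : ℕ) (μ : Fin n → AdjointCochar H) (x y : MvLaurentPoly n k ⊗[k] 𝔤) :
    twist d μ ⁅x, y⁆ = ⁅twist d μ x, twist d μ y⁆ := by
  have h : ∀ x, twist d μ x =
      Ad H (cocharPoint μ (varUnit MvPolynomial.X)) (extMap 𝔤 (rootCover n k d) x) := fun _ => rfl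
  rw [h, h, h, LieHom.map_lie, Ad_lie]

variable {ι : Type*} [Finite ι] {b : Module.Basis ι k 𝔤} {wt : ι → Weight k H 𝔤}

theorem twist_mem_regularPart_iff (hb : ∀ i, b i ∈ weightSpaceOf H (wt i)) {d : ℕ} (hd : 0 < d)
    (μ : Fin n → AdjointCochar H) (h : MvLaurentPoly n k ⊗[k] 𝔤) :
    twist d μ h ∈ regularPart k 𝔤 n ↔ ∀ i,
      (scaledBasis MvPolynomial.X b (poleBound wt d μ)).repr h i ∈
        Set.range (algebraMap (MvPolynomial (Fin n) k) (MvLaurentPoly n k)) := by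
  rw [regularPart, mem_range_extMap b]
  refine forall_congr' fun i => ?_
  rw [scaledBasis_repr]
  refine Iff.trans ?_ (varMonomial_mul_rootCover_mem_range_iff hd _ _)
  rw [← repr_extMap]
  have := repr_Ad hb (cocharPoint μ (varUnit MvPolynomial.X)) (extMap 𝔤 (rootCover n k d) h) i
  exact iff_of_eq (congrArg (· ∈ Set.range (algebraMap (MvPolynomial (Fin n) k) _)) this)

theorem etaConj_mem_range_iff (hb : ∀ i, b i ∈ weightSpaceOf H (wt i)) {d : ℕ} (hd : 0 < d)
    (μ : Fin n → AdjointCochar H) {R : Type*} [CommRing R] [Algebra k R]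
    (h : MvLaurentSeries n R ⊗[k] 𝔤) :
    etaConj d μ h ∈ Set.range (extMap 𝔤 (seriesMap (n := n)
      (IsScalarTower.toAlgHom k (MvPowerSeries (Fin n) R) (MvLaurentSeries n R)))) ↔ ∀ i,
      (scaledBasis MvPowerSeries.X b (poleBound wt d μ)).repr h i ∈
        Set.range (algebraMap (MvPowerSeries (Fin n) R) (MvLaurentSeries n R)) := by
  rw [mem_range_extMap b]
  refine forall_congr' fun i => ?_
  rw [scaledBasis_repr]
  refine Iff.trans ?_ (varMonomial_mul_loopPullback_mem_range_iff (k := k) hd _ _)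
  have hu : (cocharPoint μ (fun j => Units.map (algebraMap (MvLaurentSeries n R)
      (MvLaurentSeries n (MvLaurentSeries n R))).toMonoidHom (varUnit MvPowerSeries.X j))
        (Multiplicative.ofAdd (weightChar H (wt i)))) = Units.map (algebraMap (MvLaurentSeries n R)
      (MvLaurentSeries n (MvLaurentSeries n R))).toMonoidHom
        (varMonomial MvPowerSeries.X fun j => μ j (weightChar H (wt i))) :=
    (map_varMonomial _ _ _).symm
  rw [etaConj, repr_Ad hb, hu, extMap_extMap, repr_extMap]
  rfl

/-- The sections over affine space: the elements of `𝔤(B₀)` that the twist makes regular. -/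
def regularSections (hb : ∀ i, b i ∈ weightSpaceOf H (wt i)) {d : ℕ} (hd : 0 < d)
    (μ : Fin n → AdjointCochar H) :
    LieSubalgebra (MvPolynomial (Fin n) k) (MvLaurentPoly n k ⊗[k] 𝔤) :=
  { Submodule.span (MvPolynomial (Fin n) k)
      (Set.range (scaledBasis MvPolynomial.X b (poleBound wt d μ))) with
    lie_mem' := by
      intro x y hx hy
      -- The span is described by regularity of the twist, a condition visibly stable under
      -- brackets; no inequality between the exponents is needed.
      have key : ∀ z, z ∈ Submodule.span (MvPolynomial (Fin n) k)
          (Set.range (scaledBasis MvPolynomial.X b (poleBound wt d μ))) ↔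
            twist d μ z ∈ regularPart k 𝔤 n := fun z => by
        rw [twist_mem_regularPart_iff hb hd, mem_span_basis_iff]
      obtain ⟨x', hx'⟩ := (key x).mp hx
      obtain ⟨y', hy'⟩ := (key y).mp hy
      refine (key _).mpr ⟨⁅x', y'⁆, ?_⟩
      rw [LieHom.map_lie, hx', hy', twist_lie] }

theorem mem_regularSections_iff (hb : ∀ i, b i ∈ weightSpaceOf H (wt i)) {d : ℕ} (hd : 0 < d)
    (μ : Fin n → AdjointCochar H) (h : MvLaurentPoly n k ⊗[k] 𝔤) :
    h ∈ regularSections hb hd μ ↔ twist d μ h ∈ regularPart k 𝔤 n := by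
  rw [twist_mem_regularPart_iff hb hd, ← mem_span_basis_iff]
  rfl

/-- The basis `∏ xⱼ ^ aᵢⱼ ⊗ bᵢ` of the sections over affine space. -/
def regularSectionsBasis (hb : ∀ i, b i ∈ weightSpaceOf H (wt i)) {d : ℕ} (hd : 0 < d)
    (μ : Fin n → AdjointCochar H) :
    Module.Basis ι (MvPolynomial (Fin n) k) (regularSections hb hd μ) :=
  Module.Basis.span (v := scaledBasis MvPolynomial.X b (poleBound wt d μ))
    (linearIndependent_restrictScalars algebraMap_laurentPoly_injective _)

theorem coe_regularSectionsBasis (hb : ∀ i, b i ∈ weightSpaceOf H (wt i)) {d : ℕ} (hd : 0 < d)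
    (μ : Fin n → AdjointCochar H) (i : ι) :
    (regularSectionsBasis hb hd μ i : MvLaurentPoly n k ⊗[k] 𝔤) =
      scaledBasis MvPolynomial.X b (poleBound wt d μ) i :=
  congrArg Subtype.val (Module.Basis.span_apply _ i)

theorem localizationMap_bijective (hb : ∀ i, b i ∈ weightSpaceOf H (wt i)) {d : ℕ} (hd : 0 < d)
    (μ : Fin n → AdjointCochar H) :
    Function.Bijective (localizationMap (regularSections hb hd μ)) := by
  let c := (regularSectionsBasis hb hd μ).baseChange (MvLaurentPoly n k)
  have hc : localizationLinearMap (regularSections hb hd μ) ∘ c =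
      scaledBasis MvPolynomial.X b (poleBound wt d μ) := by
    funext i
    rw [Function.comp_apply, Module.Basis.baseChange_apply, localizationLinearMap_tmul, one_smul,
      coe_regularSectionsBasis]
  constructor
  · exact injective_of_linearIndependent_comp c (localizationLinearMap _)
      (by rw [hc]; exact Module.Basis.linearIndependent _)
  · have h : LinearMap.range (localizationLinearMap (regularSections hb hd μ)) = ⊤ := by
      rw [range_eq_span_comp c, hc, Module.Basis.span_eq]
    exact LinearMap.range_eq_top.mp h

theorem posLoopLinearMap_comp_basis (hb : ∀ i, b i ∈ weightSpaceOf H (wt i)) {d : ℕ} (hd : 0 < d)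
    (μ : Fin n → AdjointCochar H) (R : Type*) [CommRing R] [Algebra k R] :
    posLoopLinearMap R (regularSections hb hd μ) ∘
        (((regularSectionsBasis hb hd μ).baseChange (MvPowerSeries (Fin n) k)).baseChange
          (MvPowerSeries (Fin n) R)) =
      scaledBasis MvPowerSeries.X b (poleBound wt d μ) := by
  funext i
  rw [Function.comp_apply, Module.Basis.baseChange_apply, Module.Basis.baseChange_apply,
    posLoopLinearMap_tmul, map_one, mul_one, one_smul, coe_regularSectionsBasis, scaledBasis_apply,
    scaledBasis_apply, extMap_tmul, expansion_varMonomial]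

theorem posLoopMap_injective (hb : ∀ i, b i ∈ weightSpaceOf H (wt i)) {d : ℕ} (hd : 0 < d)
    (μ : Fin n → AdjointCochar H) (R : Type*) [CommRing R] [Algebra k R] :
    Function.Injective (posLoopMap R (regularSections hb hd μ)) :=
  injective_of_linearIndependent_comp _ (posLoopLinearMap R (regularSections hb hd μ)) (by
    rw [posLoopLinearMap_comp_basis]
    exact linearIndependent_restrictScalars (algebraMap_laurentSeries_injective n R) _)

variable [LieAlgebra.IsKilling k 𝔤]

/-- The definition lets `d` vary with `h`; as `poleBound` does not depend on `d`, one fixed `d`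
tests every `h`. -/
theorem mem_nParahoric_iff (hb : ∀ i, b i ∈ weightSpaceOf H (wt i)) {θ : Fin n → apartment H}
    {d : ℕ} (hd : 0 < d) {μ : Fin n → AdjointCochar H} (hμ : IsMultiple d θ μ)
    {R : Type*} [CommRing R] [Algebra k R] (h : MvLaurentSeries n R ⊗[k] 𝔤) :
    h ∈ nParahoric θ R ↔ ∀ i, (scaledBasis MvPowerSeries.X b (poleBound wt d μ)).repr h i ∈
      Set.range (algebraMap (MvPowerSeries (Fin n) R) (MvLaurentSeries n R)) := by
  rw [← etaConj_mem_range_iff hb hd]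
  constructor
  · rintro ⟨d', hd', μ', hμ', h'⟩
    rwa [etaConj_mem_range_iff hb hd, poleBound_eq wt hd hd' hμ hμ', ← etaConj_mem_range_iff hb hd']
  · exact fun h' => ⟨d, hd, μ, hμ, h'⟩

theorem range_posLoopMap (hb : ∀ i, b i ∈ weightSpaceOf H (wt i)) {θ : Fin n → apartment H} {d : ℕ}
    (hd : 0 < d) {μ : Fin n → AdjointCochar H} (hμ : IsMultiple d θ μ) (R : Type*) [CommRing R]
    [Algebra k R] :
    Set.range (posLoopMap R (regularSections hb hd μ)) = nParahoric θ R := by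
  have h := range_eq_span_comp _ (posLoopLinearMap R (regularSections hb hd μ)) |>.trans
    (by rw [posLoopLinearMap_comp_basis])
  ext x
  rw [mem_nParahoric_iff hb hd hμ, ← mem_span_basis_iff, ← h]
  rfl

end Parahoric

end ParahoricLie

end

/-! ### The theorem. -/

theorem theorem4p4 {k : Type u} [Field k] [CharZero k] [IsAlgClosed k]
    {𝔤 : Type w} [LieRing 𝔤] [LieAlgebra k 𝔤] [FiniteDimensional k 𝔤] [LieAlgebra.IsSimple k 𝔤]
    (H : LieSubalgebra k 𝔤) [H.IsCartanSubalgebra]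
    (n : ℕ) (θ : Fin n → ParahoricLie.apartment H) :
    -- some multiple `d Θ`, `d ≥ 1`, consists of cocharacters of `T_ad`
    (∃ d : ℕ, 0 < d ∧ ∃ μ : Fin n → ParahoricLie.AdjointCochar H, ParahoricLie.IsMultiple d θ μ) ∧
    ∃ ℛ : LieSubalgebra (MvPolynomial (Fin n) k) (ParahoricLie.MvLaurentPoly n k ⊗[k] 𝔤),
      -- `ℛ = j⁻¹(j(𝔤(k[x^{±1}])) ∩ 𝔤(k[y]))`, for every choice of `d`
      (∀ d : ℕ, 0 < d → ∀ μ : Fin n → ParahoricLie.AdjointCochar H, ParahoricLie.IsMultiple d θ μ →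
        (ℛ : Set (ParahoricLie.MvLaurentPoly n k ⊗[k] 𝔤)) =
          ParahoricLie.twist d μ ⁻¹'
            (Set.range (ParahoricLie.twist d μ) ∩ ParahoricLie.regularPart k 𝔤 n)) ∧
      -- `ℛ` is locally free of finite rank
      Module.Finite (MvPolynomial (Fin n) k) ℛ ∧
      Module.Projective (MvPolynomial (Fin n) k) ℛ ∧
      -- `ℛ` extends the trivial bundle with fibre `𝔤`
      (∃ e₀ : (ParahoricLie.MvLaurentPoly n k ⊗[MvPolynomial (Fin n) k] ℛ)
          ≃ₗ⁅ParahoricLie.MvLaurentPoly n k⁆ (ParahoricLie.MvLaurentPoly n k ⊗[k] 𝔤),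
        ∀ (b : ParahoricLie.MvLaurentPoly n k) (m : ℛ),
          e₀ (b ⊗ₜ m) = b • (m : ParahoricLie.MvLaurentPoly n k ⊗[k] 𝔤)) ∧
      -- `Lₙ⁺(ℛ|_V) = Lₙ⁺(𝔓_Θ)` as subfunctors of `Lₙ𝔤`
      ∃ e : ∀ (R : Type v) [CommRing R] [Algebra k R],
          ParahoricLie.PosLoop n k (ParahoricLie.FormalNhd n k ℛ) R
            →ₗ⁅MvPowerSeries (Fin n) R⁆ (ParahoricLie.MvLaurentSeries n R ⊗[k] 𝔤),
        (∀ (R : Type v) [CommRing R] [Algebra k R],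
          (∀ (f : MvPowerSeries (Fin n) R) (g : MvPowerSeries (Fin n) k) (m : ℛ),
            e R (f ⊗ₜ (g ⊗ₜ m)) = (f * algebraMap _ (MvPowerSeries (Fin n) R) g) •
              ParahoricLie.extMap 𝔤 (ParahoricLie.expansion n k R)
                (m : ParahoricLie.MvLaurentPoly n k ⊗[k] 𝔤)) ∧
          Function.Injective (e R) ∧
          Set.range (e R) = ParahoricLie.nParahoric θ R) ∧
        ∀ (R R' : Type v) [CommRing R] [Algebra k R] [CommRing R'] [Algebra k R'] (φ : R →ₐ[k] R')
          (f : MvPowerSeries (Fin n) R) (s : ParahoricLie.FormalNhd n k ℛ),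
          e R' (MvPowerSeries.map φ.toRingHom f ⊗ₜ s) =
            ParahoricLie.extMap 𝔤 (ParahoricLie.seriesMap φ) (e R (f ⊗ₜ s)) := by
  open ParahoricLie in
  obtain ⟨d, hd, μ, hμ⟩ := exists_isMultiple θ
  obtain ⟨m, b, wt, hb⟩ := exists_weight_basis (k := k) H
  refine ⟨⟨d, hd, μ, hμ⟩, regularSections hb hd μ, ?_,
    Module.Finite.of_basis (regularSectionsBasis hb hd μ),
    Module.Projective.of_basis (regularSectionsBasis hb hd μ),
    ⟨LieEquiv.ofBijective _ (localizationMap_bijective hb hd μ),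
      fun r s => localizationMap_tmul _ r s⟩,
    fun R _ _ => posLoopMap R _,
    fun R _ _ => ⟨posLoopMap_tmul R _, posLoopMap_injective hb hd μ R,
      range_posLoopMap hb hd hμ R⟩,
    fun R R' _ _ _ _ φ f s => posLoopMap_natural R _ φ f s⟩
  intro d' hd' μ' hμ'
  ext x
  rw [SetLike.mem_coe, mem_regularSections_iff, twist_mem_regularPart_iff hb hd,
    poleBound_eq wt hd hd' hμ hμ', ← twist_mem_regularPart_iff hb hd']
  -- Inside a preimage under `twist`, intersecting with its range changes nothing.
  exact ⟨fun h => ⟨⟨x, rfl⟩, h⟩, fun h => h.2⟩
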